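/- Let $X$ be a homogeneous chain, i.e. a non-empty linearly ordered set on which the group $\mathrm{Aut}(X)$ of order-preserving bijections acts transitively. An interval of a chain is an order-convex subset. A non-empty interval $J$ of a chain $Y$ is called regular if for all $x,y\in J$ and $g\in\mathrm{Aut}(Y)$, $g(x)\in J$ implies $g(y)\in J$; a homogeneous chain $Y$ is called simple if its only regular intervals are the one-point sets and $Y$ itself. Let $\tau_p$ be the topology of pointwise convergence on $\mathrm{Aut}(X)$, where $X$ carries the topology of the linear order, and let $\tau_\partial$ be the permutation topology on $\mathrm{Aut}(X)$, i.e. the topology of pointwise convergence where $X$ carries the discrete topology (the stabilizers of points form a subbase of neighbourhoods of the identity); both are group topologies. A topological group is Roelcke precompact if its Roelcke uniformity $L\wedge R$ (the finest uniformity coarser than both the left and the right uniformity) is totally bounded. Suppose that $X$ has an infinite interval $J$ (possibly $J=X$; for example, but not necessarily, a regular interval of $X$) that is a simple homogeneous chain in the induced order. Then $(\mathrm{Aut}(X),\tau_p)$ is Roelcke precompact if and only if $(\mathrm{Aut}(X),\tau_\partial)$ is Roelcke precompact. -/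

import Mathlib

/-- A homogeneous chain: a non-empty linearly ordered set on which the group `X ≃o X` of
order automorphisms acts transitively. -/
def IsHomogeneousChain (X : Type*) [LinearOrder X] : Prop :=
  Nonempty X ∧ ∀ x y : X, ∃ g : X ≃o X, g x = y

/-- A regular interval of a chain: a non-empty order-convex set `J` such that every automorphism
sending one point of `J` into `J` sends all of `J` into `J`. -/
structure IsRegularInterval {X : Type*} [LinearOrder X] (J : Set X) : Prop where
  nonempty : J.Nonempty
  ordConnected : J.OrdConnected
  regular : ∀ x ∈ J, ∀ y ∈ J, ∀ g : X ≃o X, g x ∈ J → g y ∈ J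

/-- A simple chain: a homogeneous chain whose only regular intervals are the one-point sets
and the whole chain. -/
def IsSimpleChain (X : Type*) [LinearOrder X] : Prop :=
  IsHomogeneousChain X ∧
    ∀ J : Set X, IsRegularInterval J → (∃ x, J = {x}) ∨ J = Set.univ

/-- The topology of pointwise convergence on `Aut(X)`, where `X` carries the topology of the
linear order: it is induced by the inclusion of `Aut(X)` into the product `X ^ X`. -/
abbrev pointwiseTopology (X : Type*) [LinearOrder X] : TopologicalSpace (X ≃o X) :=
  TopologicalSpace.induced (fun (g : X ≃o X) (x : X) => g x)
    (@Pi.topologicalSpace X (fun _ => X) (fun _ => Preorder.topology X))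

/-- The permutation topology on `Aut(X)`: pointwise convergence, where `X` is discrete. -/
abbrev permutationTopology (X : Type*) [LinearOrder X] : TopologicalSpace (X ≃o X) :=
  TopologicalSpace.induced (fun (g : X ≃o X) (x : X) => g x)
    (@Pi.topologicalSpace X (fun _ => X) (fun _ => ⊥))

theorem isTopologicalGroup_pointwiseTopology (X : Type*) [LinearOrder X] :
    @IsTopologicalGroup (X ≃o X) (pointwiseTopology X) _ := by
  let tX : TopologicalSpace X := Preorder.topology X
  have : OrderTopology X := ⟨rfl⟩
  let := pointwiseTopology X
  have hev : ∀ x : X, Continuous (fun g : X ≃o X => g x) := fun x =>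
    (continuous_apply x).comp continuous_induced_dom
  have key : ∀ {Y : Type _} [TopologicalSpace Y] (F : Y → (X ≃o X)),
      (∀ x, Continuous fun y => F y x) → Continuous F := by
    intro Y _ F h
    exact continuous_induced_rng.2 (continuous_pi h)
  refine { continuous_mul := key _ fun x => ?_, continuous_inv := key _ fun x => ?_ }
  · rw [continuous_iff_continuousAt]
    rintro ⟨f, g⟩
    have hf : ∀ z, Filter.Tendsto (fun p : (X ≃o X) × (X ≃o X) => p.1 z)
        (nhds (f, g)) (nhds (f z)) :=
      fun z => ((hev z).comp continuous_fst).tendsto (f, g)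
    have hg : Filter.Tendsto (fun p : (X ≃o X) × (X ≃o X) => p.2 x)
        (nhds (f, g)) (nhds (g x)) := ((hev x).comp continuous_snd).tendsto (f, g)
    refine tendsto_order.2 ⟨fun a ha => ?_, fun a ha => ?_⟩
    · change a < f (g x) at ha
      have ha' : f.symm a < g x := by rwa [OrderIso.symm_apply_lt]
      by_cases hz : ∃ z, f.symm a < z ∧ z < g x
      · obtain ⟨z, hz1, hz2⟩ := hz
        rw [OrderIso.symm_apply_lt] at hz1
        filter_upwards [(hf z).eventually (lt_mem_nhds hz1), hg.eventually (lt_mem_nhds hz2)]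
          with p h1 h2
        exact h1.trans (p.1.lt_iff_lt.2 h2)
      · filter_upwards [(hf (g x)).eventually (lt_mem_nhds ha),
          hg.eventually (lt_mem_nhds ha')] with p h1 h2
        refine lt_of_lt_of_le h1 (p.1.le_iff_le.2 (not_lt.1 fun h3 => hz ⟨_, h2, h3⟩))
    · change f (g x) < a at ha
      have ha' : g x < f.symm a := by rwa [OrderIso.lt_symm_apply]
      by_cases hz : ∃ z, g x < z ∧ z < f.symm a
      · obtain ⟨z, hz1, hz2⟩ := hz
        rw [OrderIso.lt_symm_apply] at hz2
        filter_upwards [(hf z).eventually (gt_mem_nhds hz2), hg.eventually (gt_mem_nhds hz1)]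
          with p h1 h2
        exact (p.1.lt_iff_lt.2 h2).trans h1
      · filter_upwards [(hf (g x)).eventually (gt_mem_nhds ha),
          hg.eventually (gt_mem_nhds ha')] with p h1 h2
        refine lt_of_le_of_lt (p.1.le_iff_le.2 (not_lt.1 fun h3 => hz ⟨_, h3, h2⟩)) h1
  · rw [continuous_iff_continuousAt]
    intro f
    refine tendsto_order.2 ⟨fun a ha => ?_, fun a ha => ?_⟩
    · change a < f.symm x at ha
      rw [OrderIso.lt_symm_apply] at ha
      filter_upwards [((hev a).tendsto f).eventually (gt_mem_nhds ha)] with p h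
      change a < p.symm x
      rwa [OrderIso.lt_symm_apply]
    · change f.symm x < a at ha
      rw [OrderIso.symm_apply_lt] at ha
      filter_upwards [((hev a).tendsto f).eventually (lt_mem_nhds ha)] with p h
      change p.symm x < a
      rwa [OrderIso.symm_apply_lt]

theorem isTopologicalGroup_permutationTopology (X : Type*) [LinearOrder X] :
    @IsTopologicalGroup (X ≃o X) (permutationTopology X) _ := by
  let tX : TopologicalSpace X := ⊥
  have : DiscreteTopology X := ⟨rfl⟩
  let := permutationTopology X
  have hev : ∀ x : X, Continuous (fun g : X ≃o X => g x) := fun x =>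
    (continuous_apply x).comp continuous_induced_dom
  have key : ∀ {Y : Type _} [TopologicalSpace Y] (F : Y → (X ≃o X)),
      (∀ x, Continuous fun y => F y x) → Continuous F := by
    intro Y _ F h
    exact continuous_induced_rng.2 (continuous_pi h)
  have hst : ∀ (f : X ≃o X) (z : X), ∀ᶠ g : X ≃o X in nhds f, g z = f z := fun f z =>
    ((hev z).tendsto f).eventually (p := fun y => y = f z) (by simp [nhds_discrete])
  refine { continuous_mul := key _ fun x => ?_, continuous_inv := key _ fun x => ?_ }
  · rw [continuous_iff_continuousAt]
    rintro ⟨f, g⟩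
    refine tendsto_nhds_of_eventually_eq ?_
    filter_upwards [(continuous_fst.tendsto (f, g)).eventually (hst f (g x)),
      (continuous_snd.tendsto (f, g)).eventually (hst g x)] with p h1 h2
    change p.1 (p.2 x) = f (g x)
    rw [h2, h1]
  · rw [continuous_iff_continuousAt]
    intro f
    refine tendsto_nhds_of_eventually_eq ?_
    filter_upwards [hst f (f.symm x)] with p h
    change p.symm x = f.symm x
    rw [OrderIso.symm_apply_eq, h, OrderIso.apply_symm_apply]

/-- The Roelcke uniformity `L ∧ R` of a topological group `(G, τ)`: the finest uniformity that is
coarser than both the left and the right uniformity. In Mathlib's order on uniformities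
(finer is smaller) this is the supremum. -/
abbrev roelckeUniformSpace (G : Type*) [Group G] (τ : TopologicalSpace G)
    (hτ : IsTopologicalGroup G) : UniformSpace G :=
  IsTopologicalGroup.leftUniformSpace G ⊔ IsTopologicalGroup.rightUniformSpace G

/-- A topological group `(G, τ)` is Roelcke precompact if its Roelcke uniformity is
totally bounded. -/
def IsRoelckePrecompact (G : Type*) [Group G] (τ : TopologicalSpace G)
    (hτ : IsTopologicalGroup G) : Prop :=
  @TotallyBounded G (roelckeUniformSpace G τ hτ) Set.univ

/-! The permutation topology is the finer one, so only the passage from the pointwise to the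
permutation topology needs work. Roelcke precompactness says that every neighbourhood `U` of the
identity admits a finite `F` with `G = U F U`. Gluing automorphisms and taking pointwise maxima and
minima gives a dichotomy for the simple chain `J` (`IsSimpleChain.free_or_unbounded`): `Aut(J)` acts
freely, or its point stabilizers have unbounded orbits.

In the unbounded case points of `J` can be moved by automorphisms supported nearby, and homogeneity
of `X` carries this to a neighbourhood of every point. If `g = u f v` with `u`, `v` near the
identity, then up to automorphisms fixing a given finite set only `f` and the relative order of
finitely many points matter, and these data take finitely many values
(`IsRoelckePrecompact.permutation_of_isMovable`).

In the free case Hölder's theorem makes `Aut(J)` commutative, which forces every automorphism of `X`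
fixing a point of `J` to fix `J` pointwise (`apply_eq_of_rigid`). For a suitable `U` and any finite
`F`, the images of a base point under `U F U` then cannot reach arbitrarily far up in `J`, against
transitivity. So the pointwise topology is not precompact and the implication is vacuous. -/

/-! ### Gluing, maxima and minima of automorphisms -/

/-- Two automorphisms agreeing at a point `q` can be glued at `q`. -/
theorem OrderIso.exists_glue {X : Type*} [LinearOrder X] (f g : X ≃o X) (q : X)
    (h : f q = g q) : ∃ k : X ≃o X, (∀ x ≤ q, k x = f x) ∧ ∀ x, q ≤ x → k x = g x := by
  have hm : StrictMono fun x => if x ≤ q then f x else g x := by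
    intro x y hxy
    by_cases hx : x ≤ q <;> by_cases hy : y ≤ q <;> simp only [hx, hy, if_true, if_false]
    · exact f.strictMono hxy
    · exact (f.monotone hx).trans_lt (h ▸ g.strictMono (not_le.1 hy))
    · exact absurd (hxy.le.trans hy) hx
    · exact g.strictMono hxy
  have hs : Function.Surjective fun x => if x ≤ q then f x else g x := by
    intro y
    rcases le_or_gt y (f q) with hy | hy
    · refine ⟨f.symm y, ?_⟩
      have : f.symm y ≤ q := f.symm_apply_le.2 hy
      simp [this]
    · refine ⟨g.symm y, ?_⟩
      have : ¬ g.symm y ≤ q := not_le.2 (g.lt_symm_apply.2 (h ▸ hy))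
      simp [this]
  refine ⟨hm.orderIsoOfSurjective _ hs, fun x hx => by simp [hx], fun x hx => ?_⟩
  rcases hx.eq_or_lt with rfl | hx
  · simp [h]
  · simp [hx]

/-- The smaller of the two preimages of a point serves as its preimage. Together with the dual
construction this truncates an automorphism between two others. -/
theorem OrderIso.exists_sup {X : Type*} [LinearOrder X] (f g : X ≃o X) :
    ∃ k : X ≃o X, ∀ x, k x = f x ⊔ g x := by
  have hm : StrictMono fun x => f x ⊔ g x := fun x y hxy =>
    max_lt_max (f.strictMono hxy) (g.strictMono hxy)
  have hs : Function.Surjective fun x => f x ⊔ g x := by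
    intro y
    rcases le_total (f.symm y) (g.symm y) with h | h
    · exact ⟨f.symm y, by simpa using g.le_symm_apply.1 h⟩
    · exact ⟨g.symm y, by simpa using f.le_symm_apply.1 h⟩
  exact ⟨hm.orderIsoOfSurjective _ hs, fun x => by simp⟩

theorem OrderIso.exists_inf {X : Type*} [LinearOrder X] (f g : X ≃o X) :
    ∃ k : X ≃o X, ∀ x, k x = f x ⊓ g x := by
  have hm : StrictMono fun x => f x ⊓ g x := fun x y hxy =>
    min_lt_min (f.strictMono hxy) (g.strictMono hxy)
  have hs : Function.Surjective fun x => f x ⊓ g x := by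
    intro y
    rcases le_total (f.symm y) (g.symm y) with h | h
    · exact ⟨g.symm y, by simpa using f.symm_apply_le.1 h⟩
    · exact ⟨f.symm y, by simpa using g.symm_apply_le.1 h⟩
  exact ⟨hm.orderIsoOfSurjective _ hs, fun x => by simp⟩

/-! ### Simple chains: stabilizers and the dichotomy -/

/-- Point stabilizers of a simple chain are maximal among the stabilizers of cuts. -/
theorem IsSimpleChain.apply_eq_of_preserves_lowerSet {Y : Type*} [LinearOrder Y]
    (hY : IsSimpleChain Y) {S : Set Y} (hS : IsLowerSet S) {s y : Y} (hs : s ∈ S) (hy : y ∉ S)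
    {a : Y} (ha : ∀ g : Y ≃o Y, g a = a → ∀ x, g x ∈ S ↔ x ∈ S)
    (g : Y ≃o Y) (hg : ∀ x, g x ∈ S ↔ x ∈ S) : g a = a := by
  let K : Set Y := {z | ∃ h : Y ≃o Y, (∀ x, h x ∈ S ↔ x ∈ S) ∧ h a = z}
  have haK : a ∈ K := ⟨1, fun _ => Iff.rfl, rfl⟩
  have hK : IsRegularInterval K := by
    refine ⟨⟨a, haK⟩, ⟨?_⟩, ?_⟩
    · rintro _ ⟨h, hh, rfl⟩ _ ⟨k, hk, rfl⟩ z ⟨hz1, hz2⟩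
      obtain ⟨f, rfl⟩ := hY.1.2 a z
      -- `f` need not preserve `S`, but its truncation `(f ⊔ h) ⊓ k` does, lying between `h ⊓ k` and
      -- `k`, and it still sends `a` to `z`.
      obtain ⟨p, hp⟩ := OrderIso.exists_sup f h
      obtain ⟨q, hq⟩ := OrderIso.exists_inf p k
      obtain ⟨m, hm⟩ := OrderIso.exists_inf h k
      refine ⟨q, fun x => ⟨fun hx => ?_, fun hx => ?_⟩, ?_⟩
      · rw [hq, hp] at hx
        rcases le_total (h x) (k x) with hhk | hhk
        · exact (hh x).1 (hS (le_inf le_sup_right hhk) hx)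
        · exact (hk x).1 (hS (le_inf (hhk.trans le_sup_right) le_rfl) hx)
      · rw [hq]
        exact hS inf_le_right ((hk x).2 hx)
      · rw [hq, hp, sup_eq_left.2 hz1, inf_eq_left.2 hz2]
    · rintro _ ⟨h, hh, rfl⟩ _ ⟨k, hk, rfl⟩ f ⟨l, hl, hlf⟩
      have hfix := ha (l⁻¹ * f * h) (by
        change l.symm (f (h a)) = a
        rw [← hlf, l.symm_apply_apply])
      have hf : ∀ x, f x ∈ S ↔ x ∈ S := fun x => by
        have h1 := hfix (h.symm x)
        have h2 := hl (l.symm (f x))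
        have h3 := hh (h.symm x)
        change l.symm (f (h (h.symm x))) ∈ S ↔ _ at h1
        rw [h.apply_symm_apply] at h1 h3
        rw [l.apply_symm_apply] at h2
        rw [h2, h1, h3]
      exact ⟨f * k, fun x => (hf _).trans (hk x), rfl⟩
  have hgK : g a ∈ K := ⟨g, hg, rfl⟩
  rcases hY.2 K hK with ⟨z, hz⟩ | hz
  · rw [hz] at haK hgK
    exact hgK.trans haK.symm
  -- The stabilizer of `S` would be transitive, although it cannot move `s` to `y`.
  · obtain ⟨h, hh, hha⟩ : s ∈ K := hz ▸ Set.mem_univ s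
    obtain ⟨k, hk, hka⟩ : y ∈ K := hz ▸ Set.mem_univ y
    rw [← hha, hh, ← hk, hka] at hs
    exact absurd hs hy

/-- The stabilizer of `b` preserves the cut `Set.Iic a`, so by maximality everything preserving that
cut, in particular the stabilizer of `a`, fixes `b`. -/
theorem IsSimpleChain.apply_eq_of_stabilizer_le {Y : Type*} [LinearOrder Y]
    (hY : IsSimpleChain Y) {a b : Y} (hab : a < b) (h : ∀ g : Y ≃o Y, g b = b → g a = a)
    (g : Y ≃o Y) (hg : g a = a) : g b = b := by
  have key : ∀ f : Y ≃o Y, f a = a → ∀ x, f x ∈ Set.Iic a ↔ x ∈ Set.Iic a := by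
    intro f hf x
    have := f.le_iff_le (x := x) (y := a)
    rwa [hf] at this
  exact hY.apply_eq_of_preserves_lowerSet (isLowerSet_Iic a) (Set.mem_Iic.2 le_rfl)
    (fun hb => hab.not_ge hb) (fun f hf => key f (h f hf)) g (key g hg)

/-- The automorphism group of a simple chain acts freely, or point stabilizers have unbounded
orbits. -/
theorem IsSimpleChain.free_or_unbounded {Y : Type*} [LinearOrder Y] (hY : IsSimpleChain Y) :
    (∀ (g : Y ≃o Y) (x : Y), g x = x → g = 1) ∨
      ∀ a b y : Y, a < b → ∃ g : Y ≃o Y, g a = a ∧ y ≤ g b := by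
  by_contra! hcon
  obtain ⟨⟨g₀, x₀, hg₀, hne⟩, a, b, y, hab, hbd⟩ := hcon
  let S : Set Y := {x | ∃ g : Y ≃o Y, g a = a ∧ x ≤ g b}
  have hS : IsLowerSet S := fun x z hzx ⟨g, hg, hx⟩ => ⟨g, hg, hzx.trans hx⟩
  have hbS : b ∈ S := ⟨1, rfl, le_rfl⟩
  have hyS : y ∉ S := fun ⟨g, hg, hx⟩ => (hbd g hg).not_ge hx
  have hinv : ∀ g : Y ≃o Y, g a = a → g⁻¹ a = a := fun g hg => g.symm_apply_eq.2 hg.symm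
  have hpres : ∀ g : Y ≃o Y, g a = a → ∀ x, g x ∈ S ↔ x ∈ S := by
    have h1 : ∀ g : Y ≃o Y, g a = a → ∀ x, x ∈ S → g x ∈ S := by
      rintro g hg x ⟨k, hk, hx⟩
      exact ⟨g * k, (congrArg g hk).trans hg, g.monotone hx⟩
    intro g hg x
    refine ⟨fun hx => ?_, h1 g hg x⟩
    have := h1 _ (hinv g hg) _ hx
    change g.symm (g x) ∈ S at this
    rwa [g.symm_apply_apply] at this
  have hba : ∀ g : Y ≃o Y, g b = b → g a = a := by
    intro g hg
    -- Replacing `g` by the identity above `b` makes it preserve `S`, because everything below `b`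
    -- lies in `S`.
    obtain ⟨k, hk1, hk2⟩ := OrderIso.exists_glue g 1 b hg
    rw [← hk1 a hab.le]
    refine hY.apply_eq_of_preserves_lowerSet hS hbS hyS hpres k fun x => ?_
    rcases le_total x b with hx | hx
    · refine iff_of_true (hS ?_ hbS) (hS hx hbS)
      rw [hk1 x hx, ← hg]
      exact g.monotone hx
    · rw [hk2 x hx]; rfl
  have hab' := hY.apply_eq_of_stabilizer_le hab hba
  -- The points with the same stabilizer as `a` form a regular interval containing `a` and `b`,
  -- hence everything; a fixed point then makes every point fixed.
  let C : Set Y := {d | ∀ g : Y ≃o Y, g a = a ↔ g d = d}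
  have hC : IsRegularInterval C := by
    refine ⟨⟨a, fun _ => Iff.rfl⟩, ⟨?_⟩, ?_⟩
    · intro d hd e he z ⟨hz1, hz2⟩
      rcases hz1.eq_or_lt with rfl | hz1
      · exact hd
      have hzd : ∀ g : Y ≃o Y, g z = z → g d = d := by
        intro g hg
        obtain ⟨k, hk1, hk2⟩ := OrderIso.exists_glue g 1 z hg
        rw [← hk1 d hz1.le]
        exact (hd k).1 ((he k).2 (hk2 e hz2))
      exact fun g => ⟨fun hg => hY.apply_eq_of_stabilizer_le hz1 hzd g ((hd g).1 hg),
        fun hg => (hd g).2 (hzd g hg)⟩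
    · intro d hd e he g hgd f
      have conj : ∀ z, (g⁻¹ * f * g) z = z ↔ f (g z) = g z := fun z => g.symm_apply_eq
      rw [hgd f, ← conj e, ← he, hd, conj]
  rcases hY.2 C hC with ⟨z, hz⟩ | hz
  · have ha : a ∈ C := fun _ => Iff.rfl
    have hb : b ∈ C := fun g => ⟨hab' g, hba g⟩
    rw [hz] at ha hb
    exact hab.ne (ha.trans hb.symm)
  · obtain ⟨f, hf⟩ := hY.1.2 a x₀
    refine hne (OrderIso.ext (funext fun w => ?_))
    have h1 : (f⁻¹ * g₀ * f) a = a := f.symm_apply_eq.2 (by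
      change g₀ (f a) = f a
      rw [hf, hg₀])
    have hw : f⁻¹ w ∈ C := hz ▸ Set.mem_univ _
    have h2 := f.symm_apply_eq.1 ((hw (f⁻¹ * g₀ * f)).1 h1)
    change g₀ (f (f.symm w)) = f (f.symm w) at h2
    rwa [f.apply_symm_apply] at h2

/-- In a homogeneous chain with unbounded point stabilizers, a point can be moved upwards inside
any open interval by an automorphism supported there. -/
theorem IsHomogeneousChain.exists_supported {Y : Type*} [LinearOrder Y]
    (hY : IsHomogeneousChain Y)
    (h : ∀ a b y : Y, a < b → ∃ g : Y ≃o Y, g a = a ∧ y ≤ g b)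
    {a x y b : Y} (hax : a < x) (hxy : x ≤ y) (hyb : y < b) :
    ∃ k : Y ≃o Y, k x = y ∧ (∀ z ≤ a, k z = z) ∧ ∀ z, b ≤ z → k z = z := by
  have up : ∀ {a x y : Y}, a < x → x ≤ y → ∃ g : Y ≃o Y, g a = a ∧ g x = y := by
    intro a x y hax hxy
    obtain ⟨g, hga, hgy⟩ := h a x y hax
    obtain ⟨f, hf⟩ := hY.2 x y
    -- Truncating `f` between `1` and `g` keeps `a` fixed and gives exactly `y` at `x`.
    obtain ⟨p, hp⟩ := OrderIso.exists_sup f 1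
    obtain ⟨q, hq⟩ := OrderIso.exists_inf p g
    refine ⟨q, ?_, ?_⟩
    · rw [hq, hp, hga]; exact inf_eq_right.2 le_sup_right
    · rw [hq, hp, hf]
      change (y ⊔ x) ⊓ g x = y
      rw [sup_eq_left.2 hxy, inf_eq_left.2 hgy]
  have two : ∀ {a b c d : Y}, a < b → c < d → ∃ g : Y ≃o Y, g a = c ∧ g b = d := by
    intro a b c d hab hcd
    obtain ⟨f, rfl⟩ := hY.2 a c
    rcases le_total (f b) d with hd | hd
    · obtain ⟨g, hg1, hg2⟩ := up (f.strictMono hab) hd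
      exact ⟨g * f, hg1, hg2⟩
    · obtain ⟨g, hg1, hg2⟩ := up hcd hd
      exact ⟨g⁻¹ * f, g.symm_apply_eq.2 hg1.symm, g.symm_apply_eq.2 hg2.symm⟩
  -- Four pieces are glued: the identity up to `a`, `k₁` on `[a, x]`, `k₂` on `[x, b]`, the identity
  -- from `b` on.
  obtain ⟨k₁, h1a, h1x⟩ := two hax (hax.trans_le hxy)
  obtain ⟨k₂, h2x, h2b⟩ := two (hxy.trans_lt hyb) hyb
  obtain ⟨m₁, hm1, hm1'⟩ := OrderIso.exists_glue 1 k₁ a h1a.symm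
  obtain ⟨m₂, hm2, hm2'⟩ := OrderIso.exists_glue m₁ k₂ x
    ((hm1' x hax.le).trans (h1x.trans h2x.symm))
  obtain ⟨m₃, hm3, hm3'⟩ := OrderIso.exists_glue m₂ 1 b
    ((hm2' b (hxy.trans_lt hyb).le).trans h2b)
  refine ⟨m₃, ?_, fun z hz => ?_, fun z hz => hm3' z hz⟩
  · rw [hm3 x (hxy.trans_lt hyb).le, hm2' x le_rfl, h2x]
  · have hzx := hz.trans hax.le
    rw [hm3 z (hzx.trans (hxy.trans_lt hyb).le), hm2 z hzx, hm1 z hz]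
    rfl

/-! ### Hölder's theorem and freely acting automorphism groups -/

theorem zpow_mono_of_one_le {T : Type*} [Group T] [Preorder T] [MulLeftMono T] {d : T}
    (hd : 1 ≤ d) : Monotone fun n : ℤ => d ^ n :=
  monotone_int_of_le_succ fun n => by
    rw [zpow_add_one]
    exact le_mul_of_one_le_right' hd

theorem exists_zpow_le_lt_zpow {T : Type*} [Group T] [LinearOrder T] [MulLeftMono T]
    [MulRightMono T] (arch : ∀ d a : T, 1 < d → ∃ n : ℕ, a ≤ d ^ n) {d : T} (hd : 1 < d)
    (a : T) : ∃ m : ℤ, d ^ m ≤ a ∧ a < d ^ (m + 1) := by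
  have hmono := zpow_mono_of_one_le hd.le
  obtain ⟨n, hn⟩ := arch d (a * d) hd
  obtain ⟨k, hk⟩ := arch d a⁻¹ hd
  have hbd : ∃ b : ℤ, ∀ z : ℤ, d ^ z ≤ a → z ≤ b := by
    refine ⟨n, fun z hz => ?_⟩
    by_contra! hlt
    have h1 : d ^ (n : ℤ) ≤ d ^ z := hmono hlt.le
    rw [zpow_natCast] at h1
    exact ((hn.trans h1).trans hz).not_gt (lt_mul_of_one_lt_right' a hd)
  have hne : ∃ z : ℤ, d ^ z ≤ a := by
    refine ⟨-k, ?_⟩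
    rw [zpow_neg, zpow_natCast]
    exact inv_le_of_inv_le' hk
  obtain ⟨m, hm, hmax⟩ := Int.exists_greatest_of_bdd hbd hne
  refine ⟨m, hm, lt_of_not_ge fun h => ?_⟩
  have := hmax _ h
  lia

/-- Hölder: an Archimedean linearly ordered group is commutative. -/
theorem commute_of_archimedean {T : Type*} [Group T] [LinearOrder T] [MulLeftMono T]
    [MulRightMono T] (arch : ∀ d a : T, 1 < d → ∃ n : ℕ, a ≤ d ^ n) (a b : T) :
    a * b = b * a := by
  wlog hlt : b * a < a * b generalizing a b
  · by_contra hne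
    rcases lt_or_gt_of_ne hne with h | h
    · exact hne (this b a h).symm
    · exact hlt h
  exfalso
  set c := a * b * (b * a)⁻¹ with hc
  have hc1 : 1 < c := by
    have := mul_lt_mul_left hlt (b * a)⁻¹
    rwa [mul_inv_cancel] at this
  -- Bracketing `a` and `b` between consecutive powers of `d` leaves two factors `d` for the
  -- commutator.
  have hd : ∀ d : T, 1 < d → c < d * d := by
    intro d hd
    obtain ⟨m, hm1, hm2⟩ := exists_zpow_le_lt_zpow arch hd a
    obtain ⟨n, hn1, hn2⟩ := exists_zpow_le_lt_zpow arch hd b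
    have h1 : a * b < d ^ (m + 1) * d ^ (n + 1) := mul_lt_mul_of_lt_of_lt hm2 hn2
    have h2 : (b * a)⁻¹ ≤ (d ^ n * d ^ m)⁻¹ := inv_le_inv_iff.2 (mul_le_mul' hn1 hm1)
    have h3 := mul_lt_mul_of_lt_of_le h1 h2
    have h4 : d ^ (m + 1) * d ^ (n + 1) * (d ^ n * d ^ m)⁻¹ = d * d := by
      rw [← zpow_add, ← zpow_add, ← zpow_neg, ← zpow_add, ← zpow_two]
      congr 1
      ring
    rwa [h4] at h3
  -- If `c = e * (e⁻¹ * c)` splits into positive factors, the bound for the second factor gives `e *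
  -- e < c`, against the bound for `e`. Otherwise `c` is the least positive element and the group is
  -- cyclic.
  by_cases hmin : ∃ e, 1 < e ∧ e < c
  · obtain ⟨e, he1, hec⟩ := hmin
    have h1 := hd (e⁻¹ * c) (by
      have := mul_lt_mul_right hec e⁻¹
      rwa [inv_mul_cancel] at this)
    have h2 : e * e < c := by
      have h3 := mul_lt_mul_right h1 e
      have h4 : e * (e⁻¹ * c * (e⁻¹ * c)) = c * e⁻¹ * c := by group
      rw [h4] at h3
      have h5 := mul_lt_mul_left h3 (c⁻¹ * e)
      have h6 : c * e⁻¹ * c * (c⁻¹ * e) = c := by group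
      rw [h6] at h5
      refine lt_of_le_of_lt ?_ h5
      have h7 : e * c * (c⁻¹ * e) = e * e := by group
      exact h7.ge
    exact h2.not_gt (hd e he1)
  · push Not at hmin
    have hpow : ∀ x : T, ∃ m : ℤ, x = c ^ m := by
      intro x
      obtain ⟨m, hm1, hm2⟩ := exists_zpow_le_lt_zpow arch hc1 x
      refine ⟨m, ?_⟩
      by_contra hne
      have h1 := mul_lt_mul_right (lt_of_le_of_ne hm1 (Ne.symm hne)) (c ^ m)⁻¹
      have h2 := mul_lt_mul_right hm2 (c ^ m)⁻¹
      rw [inv_mul_cancel] at h1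
      rw [zpow_add_one, inv_mul_cancel_left] at h2
      exact (hmin _ h1).not_gt h2
    obtain ⟨m, hm⟩ := hpow a
    obtain ⟨n, hn⟩ := hpow b
    rw [hm, hn, ← zpow_add, ← zpow_add, add_comm] at hlt
    exact lt_irrefl _ hlt

/-- The maximum of `g⁻¹ * f` and `1` fixes `x`, so it is `1` everywhere. Comparison at one point
thus gives a bi-invariant order on the group. -/
theorem le_of_le_of_free {Y : Type*} [LinearOrder Y]
    (hfree : ∀ (g : Y ≃o Y) (x : Y), g x = x → g = 1) {f g : Y ≃o Y} {x : Y}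
    (h : f x ≤ g x) (y : Y) : f y ≤ g y := by
  obtain ⟨p, hp⟩ := OrderIso.exists_sup (g⁻¹ * f) 1
  have h1 : p x = x := by
    rw [hp]
    exact sup_eq_right.2 (g.symm_apply_le.2 h)
  have h2 : (g⁻¹ * f) y ≤ p y := hp y ▸ le_sup_left
  rw [hfree p x h1] at h2
  exact g.symm_apply_le.1 h2

/-- A simple chain with freely acting automorphism group has a commutative automorphism group. -/
theorem IsSimpleChain.mul_comm_of_free {Y : Type*} [LinearOrder Y] (hY : IsSimpleChain Y)
    (hfree : ∀ (g : Y ≃o Y) (x : Y), g x = x → g = 1) (a b : Y ≃o Y) : a * b = b * a := by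
  obtain ⟨x₀⟩ := hY.1.1
  have hinj : ∀ f g : Y ≃o Y, f x₀ = g x₀ → f = g := fun f g h =>
    (inv_mul_eq_one.1 (hfree (f⁻¹ * g) x₀ (f.symm_apply_eq.2 h.symm)))
  let _ : LinearOrder (Y ≃o Y) := LinearOrder.lift' (fun g => g x₀) hinj
  have : MulLeftMono (Y ≃o Y) := ⟨fun h f g (hfg : f x₀ ≤ g x₀) => h.monotone hfg⟩
  have : MulRightMono (Y ≃o Y) := ⟨fun h f g (hfg : f x₀ ≤ g x₀) =>
    le_of_le_of_free hfree hfg (h x₀)⟩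
  refine commute_of_archimedean (fun d a hd => ?_) a b
  have hmono : ∀ {m n : ℕ}, m ≤ n → d ^ m ≤ d ^ n := fun h => pow_le_pow_right' hd.le h
  -- The convex subgroup generated by `d`. Its orbit of `x₀` is a regular interval with two distinct
  -- points `x₀` and `d x₀`, hence all of `Y`: the order is Archimedean.
  let H : Subgroup (Y ≃o Y) :=
    { carrier := {h | ∃ n : ℕ, h ≤ d ^ n ∧ h⁻¹ ≤ d ^ n}
      one_mem' := ⟨0, by simp⟩
      mul_mem' := by
        rintro h k ⟨n, hn1, hn2⟩ ⟨m, hm1, hm2⟩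
        refine ⟨n + m, ?_, ?_⟩
        · rw [pow_add]; exact mul_le_mul' hn1 hm1
        · rw [mul_inv_rev, add_comm, pow_add]; exact mul_le_mul' hm2 hn2
      inv_mem' := by
        rintro h ⟨n, hn1, hn2⟩
        exact ⟨n, hn2, by rwa [inv_inv]⟩ }
  let C : Set Y := {y | ∃ h ∈ H, h x₀ = y}
  have hmem : ∀ h : Y ≃o Y, h x₀ ∈ C → h ∈ H := by
    rintro h ⟨k, hk, hkh⟩
    rwa [← hinj _ _ hkh]
  have hC : IsRegularInterval C := by
    refine ⟨⟨x₀, 1, H.one_mem, rfl⟩, ⟨?_⟩, ?_⟩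
    · rintro _ ⟨h, ⟨n, hn1, hn2⟩, rfl⟩ _ ⟨k, ⟨m, hm1, hm2⟩, rfl⟩ z ⟨hz1, hz2⟩
      obtain ⟨f, rfl⟩ := hY.1.2 x₀ z
      exact ⟨f, ⟨n + m, (show f ≤ k from hz2).trans (hm1.trans (hmono (by lia))),
        (inv_le_inv_iff.2 (show h ≤ f from hz1)).trans (hn2.trans (hmono (by lia)))⟩, rfl⟩
    · rintro _ ⟨h, hh, rfl⟩ _ ⟨k, hk, rfl⟩ g hg
      have h1 : g * h ∈ H := hmem _ hg
      refine ⟨g * k, ?_, rfl⟩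
      have h2 := H.mul_mem h1 (H.mul_mem (H.inv_mem hh) hk)
      rwa [show g * h * (h⁻¹ * k) = g * k by group] at h2
  have hdC : d x₀ ∈ C := ⟨d, ⟨1, by simp, by
    rw [pow_one]; exact (Left.inv_le_one_iff.2 hd.le).trans hd.le⟩, rfl⟩
  rcases hY.2 C hC with ⟨z, hz⟩ | hz
  · have h1 : x₀ ∈ C := ⟨1, H.one_mem, rfl⟩
    rw [hz] at h1 hdC
    exact absurd (hinj 1 d (h1.trans hdC.symm)) hd.ne
  · obtain ⟨n, hn, -⟩ := hmem a (hz ▸ Set.mem_univ _)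
    exact ⟨n, hn⟩

/-! ### Rigid intervals inside the whole chain -/

/-- An automorphism of a convex set extends by the identity. -/
theorem OrderIso.exists_extend {X : Type*} [LinearOrder X] {J : Set X} (hJ : J.OrdConnected)
    (t : J ≃o J) : ∃ k : X ≃o X, (∀ x : J, k x = t x) ∧ ∀ x ∉ J, k x = x := by
  classical
  have hm : StrictMono fun x : X => if hx : x ∈ J then (t ⟨x, hx⟩ : X) else x := by
    intro x y hxy
    by_cases hx : x ∈ J <;> by_cases hy : y ∈ J <;> simp only [hx, hy, dif_pos, dif_neg,
      not_false_eq_true]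
    · exact t.strictMono (show (⟨x, hx⟩ : J) < ⟨y, hy⟩ from hxy)
    · exact lt_of_not_ge fun h => hy (hJ.out hx (t ⟨x, hx⟩).2 ⟨hxy.le, h⟩)
    · exact lt_of_not_ge fun h => hx (hJ.out (t ⟨y, hy⟩).2 hy ⟨h, hxy.le⟩)
    · exact hxy
  have hs : Function.Surjective fun x : X => if hx : x ∈ J then (t ⟨x, hx⟩ : X) else x := by
    intro y
    by_cases hy : y ∈ J
    · exact ⟨t.symm ⟨y, hy⟩, by simp⟩
    · exact ⟨y, by simp [hy]⟩
  exact ⟨hm.orderIsoOfSurjective _ hs, fun x => by simp, fun x hx => by simp [hx]⟩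

/-- An automorphism preserving a set restricts to it. -/
theorem OrderIso.exists_restrict {X : Type*} [LinearOrder X] {J : Set X} (k : X ≃o X)
    (hk : ∀ x, k x ∈ J ↔ x ∈ J) : ∃ t : J ≃o J, ∀ x : J, (t x : X) = k x := by
  have hm : StrictMono fun x : J => (⟨k x, (hk x).2 x.2⟩ : J) := fun x y hxy =>
    k.strictMono (show (x : X) < y from hxy)
  have hs : Function.Surjective fun x : J => (⟨k x, (hk x).2 x.2⟩ : J) := fun y =>
    ⟨⟨k.symm y, (hk _).1 (by rw [k.apply_symm_apply]; exact y.2)⟩, Subtype.ext (by simp)⟩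
  exact ⟨hm.orderIsoOfSurjective _ hs, fun x => by simp⟩

/-- A homogeneous chain with two points has no least element. -/
theorem IsHomogeneousChain.exists_lt {Y : Type*} [LinearOrder Y] (hY : IsHomogeneousChain Y)
    [Nontrivial Y] (x : Y) : ∃ y, y < x := by
  obtain ⟨a, b, hab⟩ := exists_pair_lt Y
  obtain ⟨g, rfl⟩ := hY.2 b x
  exact ⟨g a, g.strictMono hab⟩

theorem IsHomogeneousChain.exists_gt {Y : Type*} [LinearOrder Y] (hY : IsHomogeneousChain Y)
    [Nontrivial Y] (x : Y) : ∃ y, x < y := by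
  obtain ⟨a, b, hab⟩ := exists_pair_lt Y
  obtain ⟨g, rfl⟩ := hY.2 a x
  exact ⟨g b, g.strictMono hab⟩

/-- In a rigid interval, an automorphism of the whole chain fixing a point cannot move a larger
point within the interval. -/
theorem apply_eq_of_rigid_of_lt {X : Type*} [LinearOrder X] {J : Set X} (hJ : J.OrdConnected)
    (hs : IsSimpleChain J) (hfree : ∀ (g : J ≃o J) (x : J), g x = x → g = 1) {p q : X}
    (hp : p ∈ J) (hq : q ∈ J) (hpq : p < q) {g : X ≃o X} (hgp : g p = p) (hgq : g q ∈ J) :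
    g q = q := by
  obtain ⟨t₀, ht₀⟩ := hs.1.2 ⟨p, hp⟩ ⟨q, hq⟩
  obtain ⟨r₀, hr₀⟩ := hs.1.2 ⟨q, hq⟩ ⟨g q, hgq⟩
  obtain ⟨t, ht, -⟩ := OrderIso.exists_extend hJ t₀
  obtain ⟨r, hr, -⟩ := OrderIso.exists_extend hJ r₀
  have htp : t p = q := (ht ⟨p, hp⟩).trans (congrArg Subtype.val ht₀)
  have hrq : r q = g q := (hr ⟨q, hq⟩).trans (congrArg Subtype.val hr₀)
  have htq : t q ∈ J := by rw [ht ⟨q, hq⟩]; exact (t₀ _).2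
  have hlt : q < t q := by
    have := t.strictMono hpq
    rwa [htp] at this
  have hrt : r (t q) = t (g q) := by
    rw [← hrq, hr ⟨q, hq⟩, ht ⟨q, hq⟩, hr, ht]
    have := hs.mul_comm_of_free hfree r₀ t₀
    exact congrArg Subtype.val (DFunLike.congr_fun this ⟨q, hq⟩)
  have hcq : (t * g * t⁻¹) q = q := by
    change t (g (t.symm q)) = q
    rw [← htp, t.symm_apply_apply, hgp]
  -- `h₁` and `h₂` agree at `p`, and by commutativity of `r₀` and `t₀` also at `t q`. Cut down to
  -- `[p, t q]`, the quotient `h₁⁻¹ * h₂` restricts to `J` with a fixed point, so it is trivial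
  -- there; at `q` this reads `g q = q`.
  obtain ⟨h₁, h1, h1'⟩ := OrderIso.exists_glue 1 (t * g * t⁻¹) q hcq.symm
  obtain ⟨h₂, h2, h2'⟩ := OrderIso.exists_glue g r q hrq.symm
  have h1t : h₁ (t q) = t (g q) := by
    rw [h1' _ hlt.le]
    change t (g (t.symm (t q))) = _
    rw [t.symm_apply_apply]
  have h2t : h₂ (t q) = t (g q) := (h2' _ hlt.le).trans hrt
  have hp1 : h₁ p = p := h1 p hpq.le
  have hq1 : h₁ q = q := h1 q le_rfl
  have hp2 : h₂ p = p := (h2 p hpq.le).trans hgp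
  have hq2 : h₂ q = g q := h2 q le_rfl
  have hap : (h₁⁻¹ * h₂) p = p := h₁.symm_apply_eq.2 (hp2.trans hp1.symm)
  have hat : (h₁⁻¹ * h₂) (t q) = t q := h₁.symm_apply_eq.2 (h2t.trans h1t.symm)
  obtain ⟨k₁, hk1, hk1'⟩ := OrderIso.exists_glue 1 (h₁⁻¹ * h₂) p hap.symm
  have hk1t : k₁ (t q) = t q := (hk1' _ (hpq.trans hlt).le).trans hat
  obtain ⟨k₂, hk2, hk2'⟩ := OrderIso.exists_glue k₁ 1 (t q) hk1t
  have hk2p : k₂ p = p := (hk2 p (hpq.trans hlt).le).trans (hk1 p le_rfl)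
  have hk2t : k₂ (t q) = t q := hk2' _ le_rfl
  have hk2q : k₂ q = (h₁⁻¹ * h₂) q := (hk2 q hlt.le).trans (hk1' q hpq.le)
  obtain ⟨s, hss⟩ := OrderIso.exists_restrict (J := J) k₂ (by
    intro x
    rcases le_total x p with hx | hx
    · rw [hk2 x (hx.trans (hpq.trans hlt).le), hk1 x hx]; rfl
    rcases le_total (t q) x with hx' | hx'
    · rw [hk2' x hx']; rfl
    refine iff_of_true (hJ.out hp htq ⟨?_, ?_⟩) (hJ.out hp htq ⟨hx, hx'⟩)
    · rw [← hk2p]; exact k₂.monotone hx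
    · rw [← hk2t]; exact k₂.monotone hx')
  have hs1 := hfree s ⟨p, hp⟩ (Subtype.ext ((hss _).trans hk2p))
  have h3 := hss ⟨q, hq⟩
  rw [hs1] at h3
  have h4 : h₁.symm (h₂ q) = q := hk2q.symm.trans h3.symm
  rw [h₁.symm_apply_eq, hq1, hq2] at h4
  exact h4

/-- An automorphism of the whole chain fixing a point of a rigid interval fixes it pointwise. -/
theorem apply_eq_of_rigid {X : Type*} [LinearOrder X] {J : Set X} (hJ : J.OrdConnected)
    (hs : IsSimpleChain J) [Nontrivial J]
    (hfree : ∀ (g : J ≃o J) (x : J), g x = x → g = 1) {p q : X}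
    (hp : p ∈ J) (hq : q ∈ J) {g : X ≃o X} (hgp : g p = p) : g q = q := by
  have htr : ∀ {a b : X}, a ∈ J → b ∈ J → ∃ t : X ≃o X, t a = b ∧
      (∀ z ∈ J, t z ∈ J) ∧ (∀ z ∉ J, t z = z) ∧ ∀ z ∈ J, t z = z → a = b := by
    intro a b ha hb
    obtain ⟨t₀, ht₀⟩ := hs.1.2 ⟨a, ha⟩ ⟨b, hb⟩
    obtain ⟨t, ht, ht'⟩ := OrderIso.exists_extend hJ t₀
    refine ⟨t, (ht ⟨a, ha⟩).trans (congrArg Subtype.val ht₀),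
      fun z hz => by rw [ht ⟨z, hz⟩]; exact (t₀ _).2, ht', fun z hz hzt => ?_⟩
    have h1 := hfree t₀ ⟨z, hz⟩ (Subtype.ext ((ht ⟨z, hz⟩).symm.trans hzt))
    rw [h1] at ht₀
    exact congrArg Subtype.val ht₀
  have both : ∀ {g : X ≃o X} {p q : X}, p ∈ J → q ∈ J → g p = p → g q ∈ J → g q = q := by
    intro g p q hp hq hgp hgq
    rcases lt_trichotomy p q with hpq | rfl | hpq
    · exact apply_eq_of_rigid_of_lt hJ hs hfree hp hq hpq hgp hgq
    · exact hgp
    -- Correcting `g` by `t` exchanges the roles: `t * g` fixes the smaller point `q`, hence also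
    -- `p`, so `t` fixes `p` and is trivial on `J`.
    · obtain ⟨t, htq, htJ, -, htfix⟩ := htr hgq hq
      have hcomp : (t * g) p = t p := congrArg t hgp
      have h1 : (t * g) p = p := apply_eq_of_rigid_of_lt hJ hs hfree hq hp hpq
        (g := t * g) htq (by rw [hcomp]; exact htJ p hp)
      exact htfix p hp (hcomp.symm.trans h1)
  by_cases hgq : g q ∈ J
  · exact both hp hq hgp hgq
  exfalso
  -- As `g q` lies outside `J`, conjugating by `g` a map supported on `J` gives an automorphism that
  -- fixes `q` but moves `p` within `J`.
  have key : ∀ b ∈ J, b ≠ p → g.symm b ∈ J → False := by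
    intro b hb hbp hgb
    obtain ⟨t, htp, -, htfix, -⟩ := htr hp hb
    have h1 : (g⁻¹ * t * g) q = q := g.symm_apply_eq.2 (htfix _ hgq)
    have h2 : (g⁻¹ * t * g) p = g.symm b := by
      change g.symm (t (g p)) = _
      rw [hgp, htp]
    have h3 := both hq hp h1 (by rwa [h2])
    rw [h2, g.symm_apply_eq, hgp] at h3
    exact hbp h3
  rcases lt_trichotomy p q with hpq | rfl | hpq
  · obtain ⟨⟨b, hb⟩, hpb⟩ := hs.1.exists_gt ⟨p, hp⟩
    have hpb : p < b := hpb
    have h1 : p < g q := by rw [← hgp]; exact g.strictMono hpq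
    have h2 : b < g q := lt_of_not_ge fun h => hgq (hJ.out hp hb ⟨h1.le, h⟩)
    refine key b hb hpb.ne' (hJ.out hp hq ⟨?_, ?_⟩)
    · rw [g.le_symm_apply, hgp]; exact hpb.le
    · rw [g.symm_apply_le]; exact h2.le
  · exact hgq (by rwa [hgp])
  · obtain ⟨⟨b, hb⟩, hpb⟩ := hs.1.exists_lt ⟨p, hp⟩
    have hpb : b < p := hpb
    have h1 : g q < p := by
      have := g.strictMono hpq
      rwa [hgp] at this
    have h2 : g q < b := lt_of_not_ge fun h => hgq (hJ.out hb hp ⟨h, h1.le⟩)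
    refine key b hb hpb.ne (hJ.out hq hp ⟨?_, ?_⟩)
    · rw [g.le_symm_apply]; exact h2.le
    · rw [g.symm_apply_le, hgp]; exact hpb.le

/-! ### Roelcke precompactness and neighbourhoods of the identity -/

/-- The relations `x ∈ U y U` generate a uniformity coarser than the left and right ones, giving one
direction. Conversely, passing from `u * f * v` to `f * v` is a right-uniform step and from `f * v`
to `f` a left-uniform one, so two steps of a Roelcke entourage suffice. -/
theorem IsRoelckePrecompact.iff_exists_finite {G : Type*} [Group G] {τ : TopologicalSpace G}
    {hτ : IsTopologicalGroup G} : IsRoelckePrecompact G τ hτ ↔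
      ∀ U ∈ nhds (1 : G), ∃ F : Set G, F.Finite ∧
        ∀ g, ∃ f ∈ F, ∃ u ∈ U, ∃ v ∈ U, g = u * f * v := by
  constructor
  · intro h U hU
    let R : Set G → Set (G × G) := fun U => {p | ∃ u ∈ U, ∃ v ∈ U, p.1 = u * p.2 * v}
    have hR : Monotone R := fun U V hUV p ⟨u, hu, v, hv, hp⟩ => ⟨u, hUV hu, v, hUV hv, hp⟩
    let N : Filter (G × G) := (nhds (1 : G)).lift' R
    have hN : ∀ {s}, s ∈ N ↔ ∃ U ∈ nhds (1 : G), R U ⊆ s := Filter.mem_lift'_sets hR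
    let u : UniformSpace G := UniformSpace.ofCore (UniformSpace.Core.mk' N
      (by
        intro r hr x
        obtain ⟨U, hU, hUr⟩ := hN.1 hr
        have h1 := mem_of_mem_nhds hU
        exact hUr ⟨1, h1, 1, h1, by simp⟩)
      (by
        intro r hr
        obtain ⟨U, hU, hUr⟩ := hN.1 hr
        refine hN.2 ⟨U⁻¹, inv_mem_nhds_one G hU, ?_⟩
        rintro ⟨x, y⟩ ⟨a, ha, b, hb, hp⟩
        refine hUr ⟨a⁻¹, ha, b⁻¹, hb, ?_⟩
        change x = a * y * b at hp
        change y = a⁻¹ * x * b⁻¹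
        rw [hp]; group)
      (by
        intro r hr
        obtain ⟨U, hU, hUr⟩ := hN.1 hr
        obtain ⟨V, hV, hVU⟩ := exists_nhds_one_split hU
        refine ⟨R V, hN.2 ⟨V, hV, subset_rfl⟩, ?_⟩
        rintro ⟨x, z⟩ ⟨y, ⟨a, ha, b, hb, h1⟩, ⟨c, hc, d, hd, h2⟩⟩
        refine hUr ⟨a * c, hVU a ha c hc, d * b, hVU d hd b hb, ?_⟩
        change x = a * y * b at h1
        change y = c * z * d at h2
        change x = a * c * z * (d * b)
        rw [h1, h2]; group))
    have hle : roelckeUniformSpace G τ hτ ≤ u := by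
      refine sup_le ?_ ?_
      · intro s hs
        obtain ⟨U, hU, hUr⟩ := hN.1 hs
        refine ⟨U⁻¹, inv_mem_nhds_one G hU, ?_⟩
        rintro ⟨x, y⟩ hxy
        refine hUr ⟨1, mem_of_mem_nhds hU, (x⁻¹ * y)⁻¹, hxy, ?_⟩
        change x = 1 * y * (x⁻¹ * y)⁻¹
        group
      · intro s hs
        obtain ⟨U, hU, hUr⟩ := hN.1 hs
        refine ⟨U⁻¹, inv_mem_nhds_one G hU, ?_⟩
        rintro ⟨x, y⟩ hxy
        refine hUr ⟨(y * x⁻¹)⁻¹, hxy, 1, mem_of_mem_nhds hU, ?_⟩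
        change x = (y * x⁻¹)⁻¹ * y * 1
        group
    obtain ⟨F, hF, hcov⟩ := h (R U) (hle (hN.2 ⟨U, hU, subset_rfl⟩))
    refine ⟨F, hF, fun g => ?_⟩
    obtain ⟨f, hf, hgf⟩ := Set.mem_iUnion₂.1 (hcov (Set.mem_univ g))
    exact ⟨f, hf, hgf⟩
  · intro h d hd
    obtain ⟨e, he, hed⟩ := @comp_mem_uniformity_sets G (roelckeUniformSpace G τ hτ) d hd
    have hl : IsTopologicalGroup.leftUniformSpace G ≤ roelckeUniformSpace G τ hτ := le_sup_left
    have hr : IsTopologicalGroup.rightUniformSpace G ≤ roelckeUniformSpace G τ hτ := le_sup_right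
    obtain ⟨U, hU, hUe⟩ := hl he
    obtain ⟨V, hV, hVe⟩ := hr he
    obtain ⟨F, hF, hcov⟩ := h (U⁻¹ ∩ V⁻¹)
      (Filter.inter_mem (inv_mem_nhds_one G hU) (inv_mem_nhds_one G hV))
    refine ⟨F, hF, fun g _ => ?_⟩
    obtain ⟨f, hf, u, hu, v, hv, rfl⟩ := hcov g
    refine Set.mem_iUnion₂.2 ⟨f, hf, hed ⟨f * v, hVe ?_, hUe ?_⟩⟩
    · change f * v * (u * f * v)⁻¹ ∈ V
      rw [show f * v * (u * f * v)⁻¹ = u⁻¹ by group]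
      exact hu.2
    · change (f * v)⁻¹ * f ∈ U
      rw [show (f * v)⁻¹ * f = v⁻¹ by group]
      exact hv.1

theorem permutationTopology_le_pointwiseTopology (X : Type*) [LinearOrder X] :
    permutationTopology X ≤ pointwiseTopology X := by
  refine induced_mono ?_
  exact iInf_mono fun x => induced_mono bot_le

theorem exists_finset_of_mem_nhds_permutationTopology {X : Type*} [LinearOrder X]
    {U : Set (X ≃o X)} (hU : U ∈ @nhds _ (permutationTopology X) 1) :
    ∃ S : Finset X, ∀ g : X ≃o X, (∀ x ∈ S, g x = x) → g ∈ U := by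
  let _ : TopologicalSpace X := ⊥
  have : DiscreteTopology X := ⟨rfl⟩
  rw [nhds_induced, Filter.mem_comap] at hU
  obtain ⟨W, hW, hWU⟩ := hU
  rw [nhds_pi, Filter.mem_pi] at hW
  obtain ⟨I, hI, t, ht, htW⟩ := hW
  refine ⟨hI.toFinset, fun g hg => hWU (htW fun i hi => ?_)⟩
  change g i ∈ t i
  rw [hg i (hI.mem_toFinset.2 hi)]
  exact mem_of_mem_nhds (ht i)

theorem setOf_apply_mem_Ioo_mem_nhds {X : Type*} [LinearOrder X] {a x b : X} (hax : a < x)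
    (hxb : x < b) :
    {g : X ≃o X | g x ∈ Set.Ioo a b} ∈ @nhds _ (pointwiseTopology X) 1 := by
  let _ : TopologicalSpace X := Preorder.topology X
  have : OrderTopology X := ⟨rfl⟩
  let _ := pointwiseTopology X
  have hev : Continuous (fun g : X ≃o X => g x) :=
    (continuous_apply x).comp continuous_induced_dom
  exact hev.continuousAt.preimage_mem_nhds (Ioo_mem_nhds hax hxb)

/-! ### Movable points and tuples -/

/-- The point `x` can be moved up to `y` by automorphisms supported arbitrarily close to the
interval between them. -/
def IsMovable {X : Type*} [LinearOrder X] (x y : X) : Prop :=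
  ∀ a < x, ∀ b, y < b → ∃ k : X ≃o X, k x = y ∧ (∀ z ≤ a, k z = z) ∧ ∀ z, b ≤ z → k z = z

theorem IsMovable.map {X : Type*} [LinearOrder X] {x y : X} (h : IsMovable x y) (g : X ≃o X) :
    IsMovable (g x) (g y) := by
  intro a ha b hb
  obtain ⟨k, hk, hka, hkb⟩ := h (g.symm a) (g.symm_apply_lt.2 ha) (g.symm b) (g.lt_symm_apply.2 hb)
  refine ⟨g * k * g⁻¹, ?_, fun z hz => ?_, fun z hz => ?_⟩
  · change g (k (g.symm (g x))) = g y
    rw [g.symm_apply_apply, hk]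
  · change g (k (g.symm z)) = z
    rw [hka _ (g.symm.monotone hz), g.apply_symm_apply]
  · change g (k (g.symm z)) = z
    rw [hkb _ (g.symm.monotone hz), g.apply_symm_apply]

/-- Having no end points, `J` allows the bounds to be tightened to points of `J`; the supported
automorphism of `J` then extends by the identity. -/
theorem isMovable_of_mem {X : Type*} [LinearOrder X] {J : Set X} (hJ : J.OrdConnected)
    [Nontrivial J] (hs : IsHomogeneousChain J)
    (h : ∀ a b y : J, a < b → ∃ g : J ≃o J, g a = a ∧ y ≤ g b)
    {x y : X} (hx : x ∈ J) (hy : y ∈ J) (hxy : x ≤ y) : IsMovable x y := by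
  intro a ha b hb
  obtain ⟨a', haa', ha'x⟩ : ∃ a' : J, a ⊔ a' = a' ∧ a' < ⟨x, hx⟩ := by
    obtain ⟨⟨c, hc⟩, hcx⟩ := hs.exists_lt ⟨x, hx⟩
    rcases le_total a c with hac | hac
    · exact ⟨⟨c, hc⟩, sup_eq_right.2 hac, hcx⟩
    · exact ⟨⟨a, hJ.out hc hx ⟨hac, ha.le⟩⟩, sup_idem _, ha⟩
  obtain ⟨b', hbb', hyb'⟩ : ∃ b' : J, (b' : X) ≤ b ∧ ⟨y, hy⟩ < b' := by
    obtain ⟨⟨c, hc⟩, hcy⟩ := hs.exists_gt ⟨y, hy⟩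
    rcases le_total c b with hbc | hbc
    · exact ⟨⟨c, hc⟩, hbc, hcy⟩
    · exact ⟨⟨b, hJ.out hy hc ⟨hb.le, hbc⟩⟩, le_rfl, hb⟩
  have haa' := sup_eq_right.1 haa'
  obtain ⟨t, ht, hta, htb⟩ := hs.exists_supported h ha'x
    (show (⟨x, hx⟩ : J) ≤ ⟨y, hy⟩ from hxy) hyb'
  obtain ⟨k, hk, hk'⟩ := OrderIso.exists_extend hJ t
  refine ⟨k, (hk ⟨x, hx⟩).trans (congrArg Subtype.val ht), fun z hz => ?_, fun z hz => ?_⟩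
  · by_cases hzJ : z ∈ J
    · rw [hk ⟨z, hzJ⟩, hta ⟨z, hzJ⟩ (hz.trans haa')]
    · exact hk' z hzJ
  · by_cases hzJ : z ∈ J
    · rw [hk ⟨z, hzJ⟩, htb ⟨z, hzJ⟩ (hbb'.trans hz)]
    · exact hk' z hzJ

/-- Finitely many points can be moved upwards simultaneously, starting with the largest one. -/
theorem exists_orderIso_of_strictMonoOn {X : Type*} [LinearOrder X] [NoMaxOrder X] (φ : X → X)
    (A : Finset X) : StrictMonoOn φ A → (∀ x ∈ A, x ≤ φ x ∧ IsMovable x (φ x)) →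
      ∀ a, (∀ x ∈ A, a < x) → ∃ k : X ≃o X, (∀ z ≤ a, k z = z) ∧ ∀ x ∈ A, k x = φ x := by
  induction A using Finset.induction_on_min with
  | empty => exact fun _ _ a _ => ⟨1, fun _ _ => rfl, by simp⟩
  | insert c A hc ih =>
    intro hφ hmov a ha
    have hcA := Finset.mem_insert_self c A
    have hsub : ∀ x ∈ A, x ∈ insert c A := fun x hx => Finset.mem_insert_of_mem hx
    obtain ⟨k, hkc, hk⟩ := ih (hφ.mono (Finset.coe_subset.2 hsub))
      (fun x hx => hmov x (hsub x hx)) c hc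
    obtain ⟨b, hcb, hb⟩ : ∃ b, φ c < b ∧ ∀ x ∈ A, b ≤ φ x := by
      rcases A.eq_empty_or_nonempty with rfl | hne
      · obtain ⟨b, hb⟩ := exists_gt (φ c)
        exact ⟨b, hb, by simp⟩
      · obtain ⟨m, hm, hmin⟩ := A.exists_min_image φ hne
        exact ⟨φ m, hφ hcA (hsub m hm) (hc m hm), hmin⟩
    -- `k` moves the larger points and fixes `c`; `l` then moves `c` while staying below their
    -- images.
    obtain ⟨l, hlc, hla, hlb⟩ := (hmov c hcA).2 a (ha c hcA) b hcb
    refine ⟨l * k, fun z hz => ?_, fun x hx => ?_⟩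
    · change l (k z) = z
      rw [hkc z (hz.trans (ha c hcA).le), hla z hz]
    · change l (k x) = φ x
      rcases Finset.mem_insert.1 hx with rfl | hx
      · rw [hkc x le_rfl, hlc]
      · rw [hk x hx, hlb _ (hb x hx)]

theorem exists_orderIso_of_le_iff_le {X ι : Type*} [LinearOrder X] [NoMaxOrder X] [NoMinOrder X]
    [Nonempty X] [Finite ι] {w m : ι → X} (h : ∀ i j, w i ≤ w j ↔ m i ≤ m j)
    (hle : ∀ i, w i ≤ m i) (hmov : ∀ i, IsMovable (w i) (m i)) :
    ∃ k : X ≃o X, ∀ i, k (w i) = m i := by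
  classical
  let _ := Fintype.ofFinite ι
  -- Equal entries of `w` have equal targets by `h`, so the choice of index is harmless; the value
  -- off the range of `w` plays no role.
  let φ : X → X := fun x => if hx : ∃ i, w i = x then m hx.choose else x
  have hφ : ∀ i, φ (w i) = m i := by
    intro i
    have hx : ∃ j, w j = w i := ⟨i, rfl⟩
    have h1 : φ (w i) = m hx.choose := dif_pos hx
    rw [h1]
    have h2 := hx.choose_spec
    exact le_antisymm ((h _ _).1 h2.le) ((h _ _).1 h2.ge)
  let A : Finset X := Finset.univ.image w
  have hA : ∀ x ∈ A, ∃ i, w i = x := fun x hx => by simpa [A] using hx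
  obtain ⟨b, hb⟩ := A.bddBelow
  obtain ⟨a, ha⟩ := exists_lt b
  obtain ⟨k, -, hk⟩ := exists_orderIso_of_strictMonoOn φ A
    (by
      intro x hx y hy hxy
      obtain ⟨i, rfl⟩ := hA x hx
      obtain ⟨j, rfl⟩ := hA y hy
      rw [hφ, hφ]
      exact lt_of_not_ge fun hji => ((h _ _).2 hji).not_gt hxy)
    (by
      intro x hx
      obtain ⟨i, rfl⟩ := hA x hx
      rw [hφ]
      exact ⟨hle i, hmov i⟩)
    a (fun x hx => ha.trans_le (hb hx))
  exact ⟨k, fun i => (hk (w i) (by simp [A])).trans (hφ i)⟩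

/-- Movability concerns upward moves only, so both tuples are raised to their pointwise maximum,
which has the same order type. -/
theorem exists_orderIso_of_isMovable {X ι : Type*} [LinearOrder X] [NoMaxOrder X] [NoMinOrder X]
    [Nonempty X] [Finite ι] {w w' : ι → X} (h : ∀ i j, w i ≤ w j ↔ w' i ≤ w' j)
    (hmov : ∀ i, IsMovable (w i) (w i ⊔ w' i)) (hmov' : ∀ i, IsMovable (w' i) (w i ⊔ w' i)) :
    ∃ k : X ≃o X, ∀ i, k (w i) = w' i := by
  have hm : ∀ i j, w i ≤ w j ↔ w i ⊔ w' i ≤ w j ⊔ w' j := by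
    intro i j
    refine ⟨fun hij => sup_le_sup hij ((h i j).1 hij), fun hij => le_of_not_gt fun hlt => ?_⟩
    exact hij.not_gt (max_lt_max hlt (lt_of_not_ge fun h' => hlt.not_ge ((h i j).2 h')))
  obtain ⟨k, hk⟩ := exists_orderIso_of_le_iff_le hm (fun i => le_sup_left) hmov
  obtain ⟨l, hl⟩ := exists_orderIso_of_le_iff_le (fun i j => (h i j).symm.trans (hm i j))
    (fun i => le_sup_right) hmov'
  exact ⟨l⁻¹ * k, fun i => l.symm_apply_eq.2 ((hk i).trans (hl i).symm)⟩

/-! ### Unbounded case: transfer to the permutation topology -/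

/-- If every point has a neighbourhood in which points are movable, Roelcke precompactness passes
from the pointwise topology to the permutation topology. -/
theorem IsRoelckePrecompact.permutation_of_isMovable {X : Type*} [LinearOrder X] [NoMaxOrder X]
    [NoMinOrder X] [Nonempty X] {l r : X → X} (hl : ∀ x, l x < x) (hr : ∀ x, x < r x)
    (hmov : ∀ x, ∀ y ∈ Set.Ioo (l x) (r x), ∀ z ∈ Set.Ioo (l x) (r x), y ≤ z → IsMovable y z)
    (hp : IsRoelckePrecompact (X ≃o X) (pointwiseTopology X)
      (isTopologicalGroup_pointwiseTopology X)) :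
    IsRoelckePrecompact (X ≃o X) (permutationTopology X)
      (isTopologicalGroup_permutationTopology X) := by
  rw [IsRoelckePrecompact.iff_exists_finite] at hp ⊢
  intro U hU
  obtain ⟨S, hS⟩ := exists_finset_of_mem_nhds_permutationTopology hU
  let W : Set (X ≃o X) := ⋂ x ∈ S, {g | g x ∈ Set.Ioo (l x) (r x)}
  have hWmem : ∀ {g}, g ∈ W → ∀ x ∈ S, g x ∈ Set.Ioo (l x) (r x) := fun hg x hx =>
    Set.mem_iInter₂.1 hg x hx
  have hW : W ∈ @nhds _ (pointwiseTopology X) 1 := (Filter.biInter_finset_mem S).2 fun x _ =>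
    setOf_apply_mem_Ioo_mem_nhds (hl x) (hr x)
  have hW' : W⁻¹ ∈ @nhds _ (pointwiseTopology X) 1 := by
    let _ := pointwiseTopology X
    have := isTopologicalGroup_pointwiseTopology X
    exact inv_mem_nhds_one _ hW
  obtain ⟨F, hF, hcov⟩ := hp _ (Filter.inter_mem hW hW')
  choose f hf u hu v hv hg using hcov
  have : Finite F := hF
  -- These points record where `S` sits on the two sides of the middle factor. The colour `c g`
  -- keeps only that factor and their relative order, and one representative per colour is chosen.
  let w : (X ≃o X) → S ⊕ S → X := fun g =>
    Sum.elim (fun x => (u g)⁻¹ x) (fun x => f g (v g x))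
  let c : (X ≃o X) → F × Set ((S ⊕ S) × (S ⊕ S)) := fun g =>
    (⟨f g, hf g⟩, {p | w g p.1 ≤ w g p.2})
  have : Finite (F × Set ((S ⊕ S) × (S ⊕ S))) := inferInstance
  refine ⟨Set.range (Function.invFun c), Set.finite_range _, fun g => ?_⟩
  set g' := Function.invFun c (c g) with hg'
  have hc : c g' = c g := Function.invFun_eq ⟨g, rfl⟩
  have hff : f g' = f g := congrArg (fun p => (p.1 : X ≃o X)) hc
  have hord : ∀ i j, w g' i ≤ w g' j ↔ w g i ≤ w g j := fun i j =>
    Set.ext_iff.1 (congrArg Prod.snd hc) (i, j)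
  have hsup : ∀ {a b y z : X}, y ∈ Set.Ioo a b → z ∈ Set.Ioo a b → y ⊔ z ∈ Set.Ioo a b :=
    fun hy hz => ⟨lt_sup_of_lt_left hy.1, sup_lt_iff.2 ⟨hy.2, hz.2⟩⟩
  have hboth : ∀ i, IsMovable (w g' i) (w g' i ⊔ w g i) ∧ IsMovable (w g i) (w g' i ⊔ w g i) := by
    rintro (x | x)
    · have h1 := hWmem (hu g').2 x x.2
      have h2 := hWmem (hu g).2 x x.2
      exact ⟨hmov x _ h1 _ (hsup h1 h2) le_sup_left, hmov x _ h2 _ (hsup h1 h2) le_sup_right⟩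
    · have h1 := hWmem (hv g').1 x x.2
      have h2 := hWmem (hv g).1 x x.2
      change IsMovable (f g' (v g' x)) (f g' (v g' x) ⊔ f g (v g x)) ∧
        IsMovable (f g (v g x)) (f g' (v g' x) ⊔ f g (v g x))
      rw [hff, ← (f g).monotone.map_sup]
      exact ⟨(hmov x _ h1 _ (hsup h1 h2) le_sup_left).map _,
        (hmov x _ h2 _ (hsup h1 h2) le_sup_right).map _⟩
  obtain ⟨k, hk⟩ := exists_orderIso_of_isMovable hord (fun i => (hboth i).1) fun i => (hboth i).2
  -- The left factor fixes `S` because `k` matches the points `u⁻¹ x`, the right one because `k`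
  -- matches the points `f (v x)`.
  refine ⟨g', ⟨c g, rfl⟩, u g * k * (u g')⁻¹, hS _ fun x hx => ?_,
    g'⁻¹ * (u g * k * (u g')⁻¹)⁻¹ * g, hS _ fun x hx => ?_, by group⟩
  · have h1 : k ((u g')⁻¹ x) = (u g)⁻¹ x := hk (Sum.inl ⟨x, hx⟩)
    change u g (k ((u g')⁻¹ x)) = x
    rw [h1]
    exact (u g).apply_symm_apply x
  · have h1 : k (f g' (v g' x)) = f g (v g x) := hk (Sum.inr ⟨x, hx⟩)
    have h2 : g'⁻¹ * (u g * k * (u g')⁻¹)⁻¹ * g = (v g')⁻¹ * (f g')⁻¹ * k⁻¹ * (f g * v g) := by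
      have e1 : (u g)⁻¹ * g = f g * v g :=
        inv_mul_eq_iff_eq_mul.2 ((hg g).trans (mul_assoc _ _ _))
      have e2 : g'⁻¹ * u g' = (v g')⁻¹ * (f g')⁻¹ :=
        (congrArg (fun p => p⁻¹ * u g') (hg g')).trans (by group)
      rw [← e1, ← e2]
      group
    rw [h2]
    change (v g').symm ((f g').symm (k.symm (f g (v g x)))) = x
    rw [← h1]
    simp

/-! ### Free case: failure of precompactness -/

/-- A chain containing a rigid simple interval is not Roelcke precompact in the pointwise
topology. -/
theorem not_isRoelckePrecompact_of_rigid {X : Type*} [LinearOrder X] (hX : IsHomogeneousChain X)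
    {J : Set X} (hJ : J.OrdConnected) (hs : IsSimpleChain J) [Nontrivial J]
    (hfree : ∀ (g : J ≃o J) (x : J), g x = x → g = 1) :
    ¬ IsRoelckePrecompact (X ≃o X) (pointwiseTopology X)
      (isTopologicalGroup_pointwiseTopology X) := by
  rw [IsRoelckePrecompact.iff_exists_finite]
  intro hp
  obtain ⟨x₀⟩ := hs.1.1
  obtain ⟨a, hax⟩ := hs.1.exists_lt x₀
  obtain ⟨b, hxb⟩ := hs.1.exists_gt x₀
  have hO : Set.Ioo (a : X) b ⊆ J := fun z hz => hJ.out a.2 b.2 ⟨hz.1.le, hz.2.le⟩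
  have hW : {g : X ≃o X | g x₀ ∈ Set.Ioo (a : X) b} ∈ @nhds _ (pointwiseTopology X) 1 :=
    setOf_apply_mem_Ioo_mem_nhds hax hxb
  have hW' : {g : X ≃o X | g x₀ ∈ Set.Ioo (a : X) b}⁻¹ ∈ @nhds _ (pointwiseTopology X) 1 := by
    let _ := pointwiseTopology X
    have := isTopologicalGroup_pointwiseTopology X
    exact inv_mem_nhds_one _ hW
  obtain ⟨F, hF, hcov⟩ := hp _ (Filter.inter_mem hW hW')
  -- Otherwise `f b` lies outside `J`, so the conjugate by `f` of a shift supported on `J` fixes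
  -- `b`; by rigidity it fixes `J` pointwise, yet it moves a point of `(a, b)`.
  have hbd : ∀ f : X ≃o X, ∃ M : J, ∀ m : J, f.symm m ∈ Set.Ioo (a : X) b → m ≤ M := by
    intro f
    by_contra! hcon
    have hfb : f b ∉ J := fun hfb => by
      obtain ⟨m, hm, hlt⟩ := hcon ⟨f b, hfb⟩
      exact (f.symm_apply_lt.1 hm.2).not_gt hlt
    obtain ⟨m, hm, -⟩ := hcon x₀
    obtain ⟨m', hm'⟩ := hs.1.exists_gt m
    obtain ⟨t, ht⟩ := hs.1.2 m m'
    obtain ⟨σ, hσ, hσ'⟩ := OrderIso.exists_extend hJ t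
    have h1 : (f⁻¹ * σ * f) b = b := f.symm_apply_eq.2 (hσ' _ hfb)
    have h2 := f.symm_apply_eq.1
      (apply_eq_of_rigid hJ hs hfree b.2 (hO hm) (g := f⁻¹ * σ * f) h1)
    change σ (f (f.symm m)) = f (f.symm m) at h2
    rw [f.apply_symm_apply, hσ, ht] at h2
    exact hm'.ne' (Subtype.ext h2)
  choose M hM using hbd
  obtain ⟨B, hB⟩ := (hF.image M).bddAbove
  obtain ⟨B', hB'⟩ := hs.1.exists_gt B
  -- The shift `s` down to `a` compensates for the displacement of `x₀` by `u⁻¹`: the matching shift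
  -- `t` dominates `s`, so `t z` still exceeds the bound `B`.
  obtain ⟨s, hsa⟩ := hs.1.2 x₀ a
  obtain ⟨z, rfl⟩ := s.surjective B'
  obtain ⟨k, hk⟩ := hX.2 x₀ z
  obtain ⟨f, hf, u, hu, v, hv, rfl⟩ := hcov k
  have hy : u.symm x₀ ∈ Set.Ioo (a : X) b := hu.2
  obtain ⟨t, ht⟩ := hs.1.2 x₀ ⟨_, hO hy⟩
  obtain ⟨τ, hτ, -⟩ := OrderIso.exists_extend hJ t
  have h1 : (u * τ) x₀ = x₀ := by
    change u (τ x₀) = x₀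
    rw [hτ, ht, u.apply_symm_apply]
  have h2 : u (τ z) = z := apply_eq_of_rigid hJ hs hfree x₀.2 z.2 h1
  have h3 : (t z : X) = f (v x₀) := by
    rw [← hτ]
    exact u.injective (h2.trans hk.symm)
  have h4 : t z ≤ M f := hM f _ (by
    rw [h3, f.symm_apply_apply]
    exact hv.1)
  have h5 : s z ≤ t z := le_of_le_of_free hfree (x := x₀) (by
    rw [hsa, ht]
    exact hy.1.le) z
  exact hB'.not_ge (h5.trans (h4.trans (hB ⟨f, hf, rfl⟩)))

theorem mainTheorem12 (X : Type*) [LinearOrder X] (hX : IsHomogeneousChain X)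
    (hJ : ∃ J : Set X, J.OrdConnected ∧ J.Infinite ∧ IsSimpleChain J) :
    IsRoelckePrecompact (X ≃o X) (pointwiseTopology X)
        (isTopologicalGroup_pointwiseTopology X) ↔
      IsRoelckePrecompact (X ≃o X) (permutationTopology X)
        (isTopologicalGroup_permutationTopology X) := by
  constructor
  · obtain ⟨J, hJ, hinf, hs⟩ := hJ
    have := hinf.to_subtype
    rcases hs.free_or_unbounded with hfree | hunb
    · exact fun hp => absurd hp (not_isRoelckePrecompact_of_rigid hX hJ hs hfree)
    · have := hX.1
      have : Nontrivial X := Subtype.val_injective.nontrivial (α := J)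
      have : NoMaxOrder X := ⟨hX.exists_gt⟩
      have : NoMinOrder X := ⟨hX.exists_lt⟩
      obtain ⟨x₀⟩ := hs.1.1
      obtain ⟨a, hax⟩ := hs.1.exists_lt x₀
      obtain ⟨b, hxb⟩ := hs.1.exists_gt x₀
      -- Transporting the interval `(a, b)` around `x₀` inside `J` gives every point of `X` a
      -- neighbourhood of movable points.
      choose h hh using hX.2 x₀
      refine IsRoelckePrecompact.permutation_of_isMovable (l := fun x => h x a)
        (r := fun x => h x b) (fun x => ?_) (fun x => ?_) fun x y hy z hz hyz => ?_
      · conv_rhs => rw [← hh x]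
        exact (h x).strictMono hax
      · conv_lhs => rw [← hh x]
        exact (h x).strictMono hxb
      · have hmem : ∀ {y}, y ∈ Set.Ioo (h x a) (h x b) → (h x).symm y ∈ J := fun hy =>
          hJ.out a.2 b.2 ⟨((h x).lt_symm_apply.2 hy.1).le, ((h x).symm_apply_lt.2 hy.2).le⟩
        have := (isMovable_of_mem hJ hs.1 hunb (hmem hy) (hmem hz)
          ((h x).symm.monotone hyz)).map (h x)
        rwa [(h x).apply_symm_apply, (h x).apply_symm_apply] at this
  · rw [IsRoelckePrecompact.iff_exists_finite, IsRoelckePrecompact.iff_exists_finite]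
    exact fun hp U hU => hp U (nhds_mono (permutationTopology_le_pointwiseTopology X) hU)
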